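/- Let $\mathcal Z$ be a compact metrizable space (for instance a compact subset of $\mathbb R^d$) with its Borel $\sigma$-algebra, let $\mathcal Y$ be a finite nonempty label set with the discrete topology, and let $c$ be a metric on $\mathcal Z\times\mathcal Y$ that induces the product topology (for instance the Euclidean distance, with labels embedded as one-hot vectors). Write $\operatorname{diam}$ for the diameter of $(\mathcal Z\times\mathcal Y,c)$ and, for probability measures $\mu,\nu$ on $\mathcal Z\times\mathcal Y$, $W(\mu,\nu)=\inf_\pi\int c\,d\pi$, the infimum being over all couplings $\pi$ of $\mu$ and $\nu$. Let $P^t,Q^t$ be probability measures on $\mathcal Z\times\mathcal Y$ with marginals $P^t_{\mathcal Z},Q^t_{\mathcal Z}$ on $\mathcal Z$, let $\alpha,\beta\in(0,1)$, and let $f,g$ be (possibly randomized) classifiers, i.e. Markov kernels from $\mathcal Z$ to $\mathcal Y$; measurable functions $f,g:\mathcal Z\to\mathcal Y$ are the deterministic case. Let $P^f$ be the law of $(z,y)$ with $z\sim P^t_{\mathcal Z}$ and $y\sim f(\cdot\mid z)$, let $Q^g$ be the law of $(z,y)$ with $z\sim Q^t_{\mathcal Z}$ and $y\sim g(\cdot\mid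 z)$, and put $$P=\alpha P^t+(1-\alpha)P^f,\qquad Q=\beta Q^t+(1-\beta)Q^g .$$ For $y\in\mathcal Y$ define the class-wise unbalanced dual distance $$\check W_y(P,Q)=\sup_{\varphi}\Big(\mathbb E_{z\sim P_{\mathcal Z}}\big[\varphi(z,y)\,P(Y=y\mid z)\big]-\mathbb E_{z\sim Q_{\mathcal Z}}\big[\varphi(z,y)\,Q(Y=y\mid z)\big]\Big)\in[0,\infty],$$ the supremum being over all functions $\varphi:\mathcal Z\times\mathcal Y\to\mathbb R$ that are 1-Lipschitz for $c$. Then $$W(P^t,Q^t)\le(1-\alpha)\operatorname{diam}\sqrt{\tfrac12\,\mathbb E_{z\sim P_{\mathcal Z}}\mathrm{KL}\big(P^t_{\mathcal Y|z}\,\big\|\,P^f_{\mathcal Y|z}\big)}+\sum_{y\in\mathcal Y}\check W_y(P,Q)+(1-\beta)\operatorname{diam}\sqrt{\tfrac12\,\mathbb E_{z\sim Q_{\mathcal Z}}\mathrm{KL}\big(Q^t_{\mathcal Y|z}\,\big\|\,Q^g_{\mathcal Y|z}\big)},$$ where the Kullback–Leibler divergences and the right-hand side may take the value $+\infty$ (with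 $0\cdot\infty=0$). -/

import Mathlib

open MeasureTheory ProbabilityTheory InformationTheory
open scoped ENNReal

noncomputable section

namespace DomainInvariance

/-- `c` is a metric on the set `X` (nonnegativity follows from the axioms). -/
structure IsMetric {X : Type*} (c : X → X → ℝ) : Prop where
  eq_zero_iff : ∀ p q, c p q = 0 ↔ p = q
  symm : ∀ p q, c p q = c q p
  triangle : ∀ p q r, c p r ≤ c p q + c q r

/-- The set `Π(P, Q)` of couplings: measures on `A × B` with marginals `P` and `Q`. -/
def couplings {A B : Type*} [MeasurableSpace A] [MeasurableSpace B]
    (P : Measure A) (Q : Measure B) : Set (Measure (A × B)) :=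
  {π | π.map Prod.fst = P ∧ π.map Prod.snd = Q}

/-- The Wasserstein distance for a (nonnegative) cost function `c`, in its primal form:
the infimum of `∫ c dπ` over all couplings `π` of `P` and `Q`. -/
def wasserstein {A B : Type*} [MeasurableSpace A] [MeasurableSpace B]
    (c : A → B → ℝ) (P : Measure A) (Q : Measure B) : ℝ≥0∞ :=
  ⨅ π ∈ couplings P Q, ∫⁻ p, ENNReal.ofReal (c p.1 p.2) ∂π

/-- The diameter of the space `X` for the metric `c`. -/
def diameter {X : Type*} (c : X → X → ℝ) : ℝ≥0∞ :=
  ⨆ (p : X) (q : X), ENNReal.ofReal (c p q)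

/-- `φ` is 1-Lipschitz for the metric `c`. -/
def IsOneLipschitz {X : Type*} (c : X → X → ℝ) (φ : X → ℝ) : Prop :=
  ∀ p q, |φ p - φ q| ≤ c p q

/-- The mixture `a μ + (1 - a) ν`, for `a ∈ [0, 1]`. -/
def mixture {X : Type*} [MeasurableSpace X] (a : ℝ) (μ ν : Measure X) : Measure X :=
  ENNReal.ofReal a • μ + ENNReal.ofReal (1 - a) • ν

instance mixture_isFiniteMeasure {X : Type*} [MeasurableSpace X] (a : ℝ) (μ ν : Measure X)
    [IsFiniteMeasure μ] [IsFiniteMeasure ν] : IsFiniteMeasure (mixture a μ ν) := by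
  constructor
  simp only [mixture, Measure.coe_add, Measure.coe_smul, Pi.add_apply, Pi.smul_apply, smul_eq_mul]
  exact ENNReal.add_lt_top.2 ⟨ENNReal.mul_lt_top ENNReal.ofReal_lt_top (measure_lt_top μ _),
    ENNReal.mul_lt_top ENNReal.ofReal_lt_top (measure_lt_top ν _)⟩

section Labelled

variable {Z Y : Type*} [MeasurableSpace Z] [MeasurableSpace Y]

/-- The classifier-labelled distribution `P^f`: draw `z` from the feature marginal of `P`, then
draw the label from the (possibly randomized) classifier `f` at `z`. -/
def labelledBy (P : Measure (Z × Y)) (f : Kernel Z Y) : Measure (Z × Y) :=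
  P.fst ⊗ₘ f

instance labelledBy_isFiniteMeasure (P : Measure (Z × Y)) [IsFiniteMeasure P] (f : Kernel Z Y)
    [IsMarkovKernel f] : IsFiniteMeasure (labelledBy P f) := by
  unfold labelledBy; infer_instance

/-- For a classifier that is a function `f : Z → Y`, the distribution `labelledBy P f` is the law
of `(z, f z)` with `z` drawn from the feature marginal of `P`. -/
theorem labelledBy_deterministic (P : Measure (Z × Y)) [IsFiniteMeasure P] (f : Z → Y)
    (hf : Measurable f) :
    labelledBy P (Kernel.deterministic f hf) = P.fst.map (fun z => (z, f z)) :=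
  Measure.compProd_deterministic hf

/-- The observed semi-labelled distribution `a P + (1 - a) P^f`. -/
def observed (a : ℝ) (P : Measure (Z × Y)) (f : Kernel Z Y) : Measure (Z × Y) :=
  mixture a P (labelledBy P f)

instance observed_isFiniteMeasure (a : ℝ) (P : Measure (Z × Y)) [IsFiniteMeasure P]
    (f : Kernel Z Y) [IsMarkovKernel f] : IsFiniteMeasure (observed a P f) := by
  unfold observed; infer_instance

variable [StandardBorelSpace Y] [Nonempty Y]

/-- `E_{z ∼ M} [KL(P_{Y|z} ‖ R_{Y|z})]`, where `P_{Y|z}` and `R_{Y|z}` are the conditional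
distributions of the label given the feature; the value may be `∞`. -/
def expectedCondKL (M : Measure Z) (P R : Measure (Z × Y)) [IsFiniteMeasure P]
    [IsFiniteMeasure R] : ℝ≥0∞ :=
  ∫⁻ z, klDiv (P.condKernel z) (R.condKernel z) ∂M

/-- The class-wise unbalanced dual distance for the label `y`, with respect to the metric `c`:
the supremum over all 1-Lipschitz `φ : Z × Y → ℝ` of
`E_{z ∼ P_Z}[φ(z, y) P(Y = y | z)] - E_{z ∼ Q_Z}[φ(z, y) Q(Y = y | z)]`.
It is `+∞` when the class `y` has different masses under `P` and `Q`. -/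
def classWiseDual (c : Z × Y → Z × Y → ℝ) (y : Y) (P Q : Measure (Z × Y))
    [IsFiniteMeasure P] [IsFiniteMeasure Q] : EReal :=
  ⨆ (φ : Z × Y → ℝ) (_ : IsOneLipschitz c φ),
    (((∫ z, φ (z, y) * (P.condKernel z).real {y} ∂P.fst)
      - ∫ z, φ (z, y) * (Q.condKernel z).real {y} ∂Q.fst : ℝ) : EReal)

end Labelled

end DomainInvariance

end

/-! By Kantorovich–Rubinstein duality it suffices to bound `∫ φ dPt - ∫ φ dQt` for each 1-Lipschitz
`φ`. Telescope through the observed mixtures `P` and `Q`. The middle term `∫ φ dP - ∫ φ dQ`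
disintegrates over features and splits over labels; `φ` competes in every class-wise supremum. For
the outer terms, `Pt - P = (1 - α)(Pt - P^f)`, and `Pt`, `P^f` share their feature marginal, so only
label conditionals differ. As `φ (z, ·)` oscillates by at most the diameter, Pinsker's inequality at
each `z`, then Jensen for the square root, gives the KL terms. The duality itself comes from
Hahn–Banach, which yields a positive functional on `C(X × X)`, and Riesz representation, which turns
it into a coupling. -/

namespace DomainInvariance

/-! ### Kantorovich duality -/

/-- A linear functional dominated by a sublinear relation: if `R ⊆ E × ℝ` is a convex cone that
projects onto `E` and contains no `(0, r)` with `r < 0`, some linear functional lies below it. -/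
theorem exists_linearMap_le_of_cone {E : Type*} [AddCommGroup E] [Module ℝ E] (R : E → Set ℝ)
    (hne : ∀ x, (R x).Nonempty)
    (hadd : ∀ x y r s, r ∈ R x → s ∈ R y → r + s ∈ R (x + y))
    (hsmul : ∀ (a : ℝ) x r, 0 < a → r ∈ R x → a * r ∈ R (a • x))
    (hzero : ∀ r ∈ R 0, 0 ≤ r) :
    ∃ L : E →ₗ[ℝ] ℝ, ∀ x, ∀ r ∈ R x, L x ≤ r := by
  have hbdd : ∀ x, BddBelow (R x) := by
    intro x
    obtain ⟨s, hs⟩ := hne (-x)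
    refine ⟨-s, fun r hr => ?_⟩
    have := hadd _ _ _ _ hr hs
    rw [add_neg_cancel] at this
    linarith [hzero _ this]
  have hle : ∀ (a : ℝ) x, 0 < a → sInf (R (a • x)) ≤ a * sInf (R x) := by
    intro a x ha
    rw [← div_le_iff₀' ha]
    refine le_csInf (hne x) fun r hr => ?_
    rw [div_le_iff₀' ha]
    exact csInf_le (hbdd _) (hsmul a x r ha hr)
  -- Hahn–Banach, extending the zero functional on the trivial subspace below the sublinear map `x ↦
  -- sInf (R x)`.
  obtain ⟨L, -, hL⟩ := exists_extension_of_le_sublinear (⊥ : E →ₗ.[ℝ] ℝ) (fun x => sInf (R x))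
    (by
      intro a ha x
      refine le_antisymm (hle a x ha) ?_
      have h := hle a⁻¹ (a • x) (inv_pos.2 ha)
      rw [inv_smul_smul₀ ha.ne'] at h
      rwa [le_inv_mul_iff₀ ha] at h)
    (by
      intro x y
      rw [← sub_le_iff_le_add]
      refine le_csInf (hne x) fun r hr => ?_
      rw [sub_le_comm]
      refine le_csInf (hne y) fun s hs => ?_
      rw [sub_le_iff_le_add']
      exact csInf_le (hbdd _) (hadd _ _ _ _ hr hs))
    (by
      rintro ⟨x, hx⟩
      obtain rfl : x = 0 := (Submodule.mem_bot ℝ).1 hx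
      have h0 : (⊥ : E →ₗ.[ℝ] ℝ) ⟨0, hx⟩ = 0 := LinearPMap.map_zero _
      rw [h0]
      exact le_csInf (hne 0) hzero)
  exact ⟨L, fun x r hr => (hL x).trans (csInf_le (hbdd x) hr)⟩

/-- Riesz–Markov–Kakutani on a compact space, for functionals on all continuous functions. -/
theorem exists_measure_integral_eq {X : Type*} [TopologicalSpace X] [T2Space X] [CompactSpace X]
    [MeasurableSpace X] [BorelSpace X] (L : C(X, ℝ) →ₗ[ℝ] ℝ) (hL : ∀ h, 0 ≤ h → 0 ≤ L h) :
    ∃ π : Measure X, IsFiniteMeasure π ∧ ∀ h : C(X, ℝ), ∫ x, h x ∂π = L h := by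
  let L' : CompactlySupportedContinuousMap X ℝ →ₗ[ℝ] ℝ :=
    { toFun := fun h => L h.toContinuousMap
      map_add' := fun h k => L.map_add h.toContinuousMap k.toContinuousMap
      map_smul' := fun a h => L.map_smul a h.toContinuousMap }
  let Λ := PositiveLinearMap.mk₀ L' (fun h hh => hL _ (ContinuousMap.le_def.2 fun x => CompactlySupportedContinuousMap.le_def.1 hh x))
  have hΛ : ∀ h : C(X, ℝ), ∫ x, h x ∂(RealRMK.rieszMeasure Λ) = L h := fun h =>
    RealRMK.integral_rieszMeasure Λ (CompactlySupportedContinuousMap.continuousMapEquiv h)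
  refine ⟨RealRMK.rieszMeasure Λ, ⟨?_⟩, hΛ⟩
  have h := RealRMK.rieszMeasure_le_of_eq_one Λ
    (f := CompactlySupportedContinuousMap.continuousMapEquiv (1 : C(X, ℝ)))
    (fun _ => zero_le_one) isCompact_univ (fun _ _ => rfl)
  exact h.trans_lt ENNReal.ofReal_lt_top

theorem integrable_continuousMap {X : Type*} [TopologicalSpace X] [CompactSpace X]
    [MeasurableSpace X] [BorelSpace X] (μ : Measure X) [IsFiniteMeasure μ] (h : C(X, ℝ)) :
    Integrable h μ :=
  (BoundedContinuousFunction.mkOfCompact h).integrable μ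

theorem measure_ext_of_integral_continuousMap {X : Type*} [TopologicalSpace X] [CompactSpace X]
    [TopologicalSpace.MetrizableSpace X] [MeasurableSpace X] [BorelSpace X] {μ ν : Measure X}
    [IsFiniteMeasure μ] [IsFiniteMeasure ν] (h : ∀ f : C(X, ℝ), ∫ x, f x ∂μ = ∫ x, f x ∂ν) :
    μ = ν := by
  let _ := TopologicalSpace.metrizableSpaceMetric X
  exact ext_of_forall_integral_eq_of_IsFiniteMeasure fun f => h f.toContinuousMap

theorem secondCountableTopology_of_compact_metrizable (X : Type*) [TopologicalSpace X]
    [CompactSpace X] [TopologicalSpace.MetrizableSpace X] : SecondCountableTopology X := by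
  let _ := TopologicalSpace.metrizableSpaceMetric X
  infer_instance

/-- **Kantorovich duality** on compact metrizable spaces (the hard inequality), with existence of
a coupling attaining the bound. -/
theorem exists_coupling_integral_le {A B : Type*}
    [TopologicalSpace A] [CompactSpace A] [TopologicalSpace.MetrizableSpace A]
    [MeasurableSpace A] [BorelSpace A]
    [TopologicalSpace B] [CompactSpace B] [TopologicalSpace.MetrizableSpace B]
    [MeasurableSpace B] [BorelSpace B]
    (μ : Measure A) (ν : Measure B) [IsProbabilityMeasure μ] [IsProbabilityMeasure ν]
    (c : C(A × B, ℝ)) (D : ℝ)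
    (hD : ∀ (φ : C(A, ℝ)) (ψ : C(B, ℝ)), (∀ a b, φ a + ψ b ≤ c (a, b)) →
      ∫ a, φ a ∂μ + ∫ b, ψ b ∂ν ≤ D) :
    ∃ π ∈ couplings μ ν, IsFiniteMeasure π ∧ ∫ p, c p ∂π ≤ D := by
  have := secondCountableTopology_of_compact_metrizable A
  have := secondCountableTopology_of_compact_metrizable B
  have hiμ := integrable_continuousMap μ
  have hiν := integrable_continuousMap ν
  -- `R h` collects the prices of dominating `h` by `φ ⊕ ψ + t c`, where `c` costs `D`. A linear `L`
  -- below all prices is positive, has the right marginals and satisfies `L c ≤ D`.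
  let R : C(A × B, ℝ) → Set ℝ := fun h => {r | ∃ (φ : C(A, ℝ)) (ψ : C(B, ℝ)) (t : ℝ), 0 ≤ t ∧
    (∀ a b, h (a, b) ≤ φ a + ψ b + t * c (a, b)) ∧
      r = ∫ a, φ a ∂μ + ∫ b, ψ b ∂ν + t * D}
  obtain ⟨L, hL⟩ := exists_linearMap_le_of_cone R
    (by
      intro h
      refine ⟨_, ContinuousMap.const A ‖h‖, 0, 0, le_rfl, fun a b => ?_, rfl⟩
      simpa using (le_abs_self _).trans (h.norm_coe_le_norm (a, b)))
    (by
      rintro h k _ _ ⟨φ, ψ, t, ht, hh, rfl⟩ ⟨φ', ψ', t', ht', hh', rfl⟩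
      refine ⟨φ + φ', ψ + ψ', t + t', add_nonneg ht ht', fun a b => ?_, ?_⟩
      · simp only [ContinuousMap.add_apply]
        linarith [hh a b, hh' a b]
      · simp only [ContinuousMap.add_apply]
        rw [integral_add (hiμ _) (hiμ _), integral_add (hiν _) (hiν _)]
        ring)
    (by
      rintro s h _ hs ⟨φ, ψ, t, ht, hh, rfl⟩
      refine ⟨s • φ, s • ψ, s * t, mul_nonneg hs.le ht, fun a b => ?_, ?_⟩
      · simp only [ContinuousMap.smul_apply, smul_eq_mul]
        nlinarith [mul_le_mul_of_nonneg_left (hh a b) hs.le]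
      · simp only [ContinuousMap.smul_apply, smul_eq_mul, integral_const_mul]
        ring)
    (by
      rintro _ ⟨φ, ψ, t, ht, hh, rfl⟩
      simp only [ContinuousMap.zero_apply] at hh
      -- If `t = 0`, integrate `0 ≤ φ a + ψ b` in `a`, then in `b`. If `t > 0`, the pair `(-φ / t,
      -- -ψ / t)` is admissible in `hD`.
      rcases ht.eq_or_lt with rfl | ht
      · have h1 : ∀ b, -ψ b ≤ ∫ a, φ a ∂μ := fun b => by
          have := integral_mono (integrable_const (-ψ b)) (hiμ φ)
            (fun a => by dsimp only; linarith [hh a b])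
          simpa using this
        have h2 := integral_mono (integrable_const (-∫ a, φ a ∂μ)) (hiν ψ)
          (fun b => by dsimp only; linarith [h1 b])
        simp at h2
        linarith
      · have := hD ((-t⁻¹) • φ) ((-t⁻¹) • ψ) (fun a b => by
          simp only [ContinuousMap.smul_apply, smul_eq_mul]
          have h := mul_le_mul_of_nonneg_left (hh a b) (inv_pos.2 ht).le
          rw [mul_zero, mul_add, inv_mul_cancel_left₀ ht.ne'] at h
          linarith)
        simp only [ContinuousMap.smul_apply, smul_eq_mul, integral_const_mul] at this
        have h := mul_le_mul_of_nonneg_left this ht.le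
        have e : t * (-t⁻¹ * ∫ a, φ a ∂μ + -t⁻¹ * ∫ b, ψ b ∂ν)
            = -(∫ a, φ a ∂μ + ∫ b, ψ b ∂ν) := by
          field_simp
          ring
        linarith)
  have hpos : ∀ h, 0 ≤ h → 0 ≤ L h := by
    intro h hh
    have := hL (-h) 0 ⟨0, 0, 0, le_rfl, fun a b => by simpa using hh (a, b), by simp⟩
    rw [map_neg] at this
    linarith
  obtain ⟨π, hπ, hint⟩ := exists_measure_integral_eq L hpos
  have hfst : ∀ φ : C(A, ℝ), L (φ.comp ContinuousMap.fst) ≤ ∫ a, φ a ∂μ := fun φ =>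
    hL _ _ ⟨φ, 0, 0, le_rfl, fun a b => by simp, by simp⟩
  have hsnd : ∀ ψ : C(B, ℝ), L (ψ.comp ContinuousMap.snd) ≤ ∫ b, ψ b ∂ν := fun ψ =>
    hL _ _ ⟨0, ψ, 0, le_rfl, fun a b => by simp, by simp⟩
  refine ⟨π, ⟨?_, ?_⟩, hπ, ?_⟩
  · refine measure_ext_of_integral_continuousMap fun φ => ?_
    rw [integral_map measurable_fst.aemeasurable φ.continuous.aestronglyMeasurable]
    refine (hint (φ.comp ContinuousMap.fst)).trans (le_antisymm (hfst φ) ?_)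
    have := hfst (-φ)
    rw [ContinuousMap.neg_comp, map_neg] at this
    simp only [ContinuousMap.neg_apply, integral_neg] at this
    linarith
  · refine measure_ext_of_integral_continuousMap fun ψ => ?_
    rw [integral_map measurable_snd.aemeasurable ψ.continuous.aestronglyMeasurable]
    refine (hint (ψ.comp ContinuousMap.snd)).trans (le_antisymm (hsnd ψ) ?_)
    have := hsnd (-ψ)
    rw [ContinuousMap.neg_comp, map_neg] at this
    simp only [ContinuousMap.neg_apply, integral_neg] at this
    linarith
  · rw [hint]
    exact hL _ _ ⟨0, 0, 1, zero_le_one, fun a b => by simp, by simp⟩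

theorem IsMetric.self {X : Type*} {c : X → X → ℝ} (hc : IsMetric c) (p : X) : c p p = 0 :=
  (hc.eq_zero_iff p p).2 rfl

theorem IsMetric.nonneg {X : Type*} {c : X → X → ℝ} (hc : IsMetric c) (p q : X) : 0 ≤ c p q := by
  have := hc.triangle p q p
  rw [hc.self, hc.symm q p] at this
  linarith

theorem IsOneLipschitz.continuous {X : Type*} [TopologicalSpace X] {c : X → X → ℝ}
    (hc : IsMetric c) (hcc : Continuous fun p : X × X => c p.1 p.2) {φ : X → ℝ}
    (hφ : IsOneLipschitz c φ) : Continuous φ := by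
  rw [continuous_iff_continuousAt]
  intro p
  have h : Filter.Tendsto (fun q => c q p) (nhds p) (nhds 0) := by
    rw [← hc.self p]
    exact (hcc.comp (continuous_id.prodMk continuous_const)).tendsto p
  exact tendsto_iff_dist_tendsto_zero.2
    (squeeze_zero (fun _ => dist_nonneg) (fun q => hφ q p) h)

/-- **Kantorovich–Rubinstein duality** on a compact metrizable space (the hard inequality). -/
theorem wasserstein_le_of_isOneLipschitz {X : Type*} [TopologicalSpace X] [CompactSpace X]
    [TopologicalSpace.MetrizableSpace X] [MeasurableSpace X] [BorelSpace X]
    {c : X → X → ℝ} (hc : IsMetric c) (hcc : Continuous fun p : X × X => c p.1 p.2)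
    (μ ν : Measure X) [IsProbabilityMeasure μ] [IsProbabilityMeasure ν] (D : ℝ)
    (hD : ∀ φ, IsOneLipschitz c φ → ∫ x, φ x ∂μ - ∫ x, φ x ∂ν ≤ D) :
    wasserstein c μ ν ≤ ENNReal.ofReal D := by
  have := secondCountableTopology_of_compact_metrizable X
  obtain ⟨π, hπ, hfin, hle⟩ := exists_coupling_integral_le μ ν ⟨_, hcc⟩ D (by
    intro φ ψ h
    simp only [ContinuousMap.coe_mk] at h
    have hX : Nonempty X := nonempty_of_isProbabilityMeasure μ
    -- The `c`-transform of `ψ` replaces the pair by one 1-Lipschitz function: `φ ≤ θ` by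
    -- admissibility, `θ ≤ -ψ` by taking `y = x`.
    let θ : X → ℝ := fun x => ⨅ y, (c x y - ψ y)
    have hbdd : ∀ x, BddBelow (Set.range fun y => c x y - ψ y) := fun x =>
      ⟨φ x, by rintro _ ⟨y, rfl⟩; dsimp only; linarith [h x y]⟩
    have hstep : ∀ p q, θ p ≤ θ q + c p q := fun p q => by
      rw [← sub_le_iff_le_add]
      refine le_ciInf fun y => ?_
      have h1 := ciInf_le (hbdd p) y
      have h2 := hc.triangle p q y
      change θ p ≤ _ at h1
      linarith
    have hθ : IsOneLipschitz c θ := fun p q => by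
      have h1 := hstep p q
      have h2 := hstep q p
      rw [hc.symm q p] at h2
      exact abs_sub_le_iff.2 ⟨by linarith, by linarith⟩
    let Θ : C(X, ℝ) := ⟨θ, hθ.continuous hc hcc⟩
    have h1 : ∫ x, φ x ∂μ ≤ ∫ x, θ x ∂μ :=
      integral_mono (integrable_continuousMap μ φ) (integrable_continuousMap μ Θ)
        fun x => le_ciInf fun y => by linarith [h x y]
    have h2 : ∫ x, ψ x ∂ν ≤ ∫ x, -θ x ∂ν :=
      integral_mono (integrable_continuousMap ν ψ) (integrable_continuousMap ν (-Θ)) fun x => by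
        have h1 := ciInf_le (hbdd x) x
        rw [hc.self] at h1
        change θ x ≤ _ at h1
        change ψ x ≤ -θ x
        linarith
    rw [integral_neg] at h2
    linarith [hD θ hθ])
  refine (iInf₂_le π hπ).trans ?_
  have hint : Integrable (fun p : X × X => c p.1 p.2) π := integrable_continuousMap π ⟨_, hcc⟩
  rw [← ofReal_integral_eq_lintegral_ofReal hint
    (Filter.Eventually.of_forall fun p => hc.nonneg p.1 p.2)]
  exact ENNReal.ofReal_le_ofReal hle

/-! ### Pinsker and Jensen inequalities -/

/-- A Donsker–Varadhan bound combined with Hoeffding's lemma. -/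
theorem mul_integral_sub_le_toReal_klDiv {X : Type*} [MeasurableSpace X] {μ ν : Measure X}
    [IsProbabilityMeasure μ] [IsProbabilityMeasure ν] (hμν : klDiv μ ν ≠ ∞)
    {φ : X → ℝ} (hm : Measurable φ) {a d : ℝ} (hφ : ∀ x, φ x ∈ Set.Icc a (a + d)) (t : ℝ) :
    t * (∫ x, φ x ∂μ - ∫ x, φ x ∂ν) ≤ (klDiv μ ν).toReal + d ^ 2 / 8 * t ^ 2 := by
  obtain ⟨hac, hint⟩ := klDiv_ne_top_iff.1 hμν
  set m := ∫ x, φ x ∂ν with hmdef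
  have hiμ : Integrable φ μ :=
    Integrable.of_mem_Icc a (a + d) hm.aemeasurable (Filter.Eventually.of_forall hφ)
  have hsub := hasSubgaussianMGF_of_mem_Icc (μ := ν) hm.aemeasurable
    (Filter.Eventually.of_forall hφ)
  have hexp := hsub.integrable_exp_mul t
  have hmgf := hsub.mgf_le t
  rw [← hmdef] at hexp hmgf
  have : IsProbabilityMeasure (ν.tilted fun x => t * (φ x - m)) :=
    isProbabilityMeasure_tilted hexp
  have hft : Integrable (fun x => t * (φ x - m)) μ := (hiμ.sub (integrable_const m)).const_mul t
  have h1 := integral_llr_tilted_right hac hft hexp hint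
  -- Nonnegativity of the divergence of `μ` from the tilted `ν`; `h1` expands it into the
  -- Donsker–Varadhan bound.
  have h2 := integral_llr_add_sub_measure_univ_nonneg
    (hac.trans (absolutelyContinuous_tilted hexp)) (integrable_llr_tilted_right hac hft hint hexp)
  have h3 := toReal_klDiv_of_measure_eq hac (by simp : μ Set.univ = ν Set.univ)
  have h4 : ∫ x, t * (φ x - m) ∂μ = t * (∫ x, φ x ∂μ - m) := by
    rw [integral_const_mul, integral_sub hiμ (integrable_const m)]
    simp
  have h5 : Real.log (∫ x, Real.exp (t * (φ x - m)) ∂ν) ≤ d ^ 2 / 8 * t ^ 2 := by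
    rw [Real.log_le_iff_le_exp (integral_exp_pos hexp)]
    refine hmgf.trans_eq ?_
    congr 1
    simp [div_pow]
    ring
  simp only [probReal_univ] at h2
  linarith

/-- **Pinsker's inequality**, in terms of a test function of bounded oscillation. -/
theorem enorm_integral_sub_le_klDiv {X : Type*} [MeasurableSpace X] (μ ν : Measure X)
    [IsProbabilityMeasure μ] [IsProbabilityMeasure ν] {φ : X → ℝ} (hm : Measurable φ) {a d : ℝ}
    (hφ : ∀ x, φ x ∈ Set.Icc a (a + d)) :
    ‖∫ x, φ x ∂μ - ∫ x, φ x ∂ν‖ₑ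
      ≤ ENNReal.ofReal d * ((1 / 2) * klDiv μ ν) ^ (1 / 2 : ℝ) := by
  have hd : 0 ≤ d := by
    obtain ⟨x⟩ := nonempty_of_isProbabilityMeasure μ
    linarith [(hφ x).1, (hφ x).2]
  rcases hd.eq_or_lt with rfl | hd'
  · have : φ = fun _ => a := funext fun x => le_antisymm (by simpa using (hφ x).2) (hφ x).1
    simp [this]
  by_cases hμν : klDiv μ ν = ∞
  · have : ENNReal.ofReal d ≠ 0 := by simpa using hd'
    rw [hμν, ENNReal.mul_top (by simp), ENNReal.top_rpow_of_pos (by norm_num),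
      ENNReal.mul_top this]
    exact le_top
  set K := (klDiv μ ν).toReal with hK
  set Δ := ∫ x, φ x ∂μ - ∫ x, φ x ∂ν with hΔ
  have hK0 : 0 ≤ K := ENNReal.toReal_nonneg
  -- A quadratic in `t` that is nonnegative everywhere has nonpositive discriminant: `Δ ^ 2 ≤ d ^ 2
  -- * K / 2`.
  have hdisc := discrim_le_zero (a := d ^ 2 / 8) (b := -Δ) (c := K) fun t => by
    have := mul_integral_sub_le_toReal_klDiv hμν hm hφ t
    rw [← hΔ, ← hK] at this
    linarith
  rw [discrim] at hdisc
  have habs : |Δ| ≤ d * (1 / 2 * K) ^ (1 / 2 : ℝ) := by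
    rw [← Real.sqrt_eq_rpow]
    refine abs_le_of_sq_le_sq ?_ (by positivity)
    rw [mul_pow, Real.sq_sqrt (by positivity)]
    nlinarith
  rw [Real.enorm_eq_ofReal_abs]
  refine (ENNReal.ofReal_le_ofReal habs).trans_eq ?_
  rw [ENNReal.ofReal_mul hd, ← ENNReal.ofReal_rpow_of_nonneg (by positivity) (by norm_num),
    ENNReal.ofReal_mul (by norm_num), hK, ENNReal.ofReal_toReal hμν]
  congr 3
  rw [ENNReal.ofReal_div_of_pos (by norm_num)]
  simp

/-- Jensen's inequality for the square root of a possibly nonmeasurable function. -/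
theorem lintegral_rpow_half_le {X : Type*} [MeasurableSpace X] (μ : Measure X)
    [IsProbabilityMeasure μ] (f : X → ℝ≥0∞) :
    ∫⁻ x, f x ^ (1 / 2 : ℝ) ∂μ ≤ (∫⁻ x, f x ∂μ) ^ (1 / 2 : ℝ) := by
  -- A measurable minorant with the same integral makes Hölder applicable; `g ^ 2 ≤ f` pointwise.
  obtain ⟨g, hg, hgf, heq⟩ := exists_measurable_le_lintegral_eq μ fun x => f x ^ (1 / 2 : ℝ)
  rw [heq]
  have h := ENNReal.lintegral_Lp_mul_le_Lq_mul_Lr (p := 1) (q := 2) (r := 2) one_pos one_lt_two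
    (by norm_num) μ hg.aemeasurable (aemeasurable_const (b := (1 : ℝ≥0∞)))
  simp only [Pi.mul_apply, mul_one, ENNReal.rpow_one, ENNReal.one_rpow, lintegral_const,
    measure_univ, div_one] at h
  refine h.trans (ENNReal.rpow_le_rpow (lintegral_mono fun x => ?_) (by norm_num))
  refine (ENNReal.rpow_le_rpow (hgf x) (by norm_num)).trans_eq ?_
  dsimp only
  rw [← ENNReal.rpow_mul]
  norm_num

/-! ### Mixtures, disintegration and class-wise splitting -/

section

variable {Z Y : Type*} [MeasurableSpace Z] [MeasurableSpace Y]

theorem labelledBy_fst (P : Measure (Z × Y)) [IsFiniteMeasure P] (f : Kernel Z Y)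
    [IsMarkovKernel f] : (labelledBy P f).fst = P.fst :=
  Measure.fst_compProd _ _

instance labelledBy_isProbabilityMeasure (P : Measure (Z × Y)) [IsProbabilityMeasure P]
    (f : Kernel Z Y) [IsMarkovKernel f] : IsProbabilityMeasure (labelledBy P f) := by
  unfold labelledBy; infer_instance

theorem observed_fst (P : Measure (Z × Y)) [IsFiniteMeasure P] (f : Kernel Z Y)
    [IsMarkovKernel f] {a : ℝ} (ha : a ∈ Set.Ioo (0 : ℝ) 1) : (observed a P f).fst = P.fst := by
  have h := labelledBy_fst P f
  simp only [Measure.fst] at h ⊢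
  rw [observed, mixture, Measure.map_add _ _ measurable_fst, Measure.map_smul, Measure.map_smul, h,
    ← add_smul, ← ENNReal.ofReal_add ha.1.le (sub_nonneg.2 ha.2.le)]
  simp

theorem integral_sub_integral_observed (P : Measure (Z × Y)) [IsFiniteMeasure P] (f : Kernel Z Y)
    [IsMarkovKernel f] {a : ℝ} (ha : a ∈ Set.Ioo (0 : ℝ) 1) {φ : Z × Y → ℝ}
    (hφ : Integrable φ P) (hφ' : Integrable φ (labelledBy P f)) :
    ∫ p, φ p ∂P - ∫ p, φ p ∂(observed a P f)
      = (1 - a) * (∫ p, φ p ∂P - ∫ p, φ p ∂(labelledBy P f)) := by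
  rw [observed, mixture, integral_add_measure (hφ.smul_measure ENNReal.ofReal_ne_top)
    (hφ'.smul_measure ENNReal.ofReal_ne_top), integral_smul_measure, integral_smul_measure,
    ENNReal.toReal_ofReal ha.1.le, ENNReal.toReal_ofReal (sub_nonneg.2 ha.2.le)]
  simp only [smul_eq_mul]
  ring

variable [StandardBorelSpace Y] [Nonempty Y]

/-- Distributions with the same feature marginal are as close as their label conditionals, in the
sense of the averaged Pinsker inequality. -/
theorem enorm_integral_sub_le_expectedCondKL (P N : Measure (Z × Y)) [IsProbabilityMeasure P]
    [IsProbabilityMeasure N] (hfst : N.fst = P.fst) {φ : Z × Y → ℝ} (hm : Measurable φ)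
    (hP : Integrable φ P) (hN : Integrable φ N)
    {d : ℝ} (hd : ∀ z, ∃ a, ∀ y, φ (z, y) ∈ Set.Icc a (a + d)) :
    ‖∫ p, φ p ∂P - ∫ p, φ p ∂N‖ₑ
      ≤ ENNReal.ofReal d * ((1 / 2) * expectedCondKL P.fst P N) ^ (1 / 2 : ℝ) := by
  have hP' := hP.integral_condKernel
  have hN' := hN.integral_condKernel
  rw [hfst] at hN'
  rw [← Measure.integral_condKernel hP, ← Measure.integral_condKernel hN, hfst,
    ← integral_sub hP' hN']
  refine (enorm_integral_le_lintegral_enorm _).trans ?_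
  calc ∫⁻ z, ‖∫ y, φ (z, y) ∂(P.condKernel z) - ∫ y, φ (z, y) ∂(N.condKernel z)‖ₑ ∂P.fst
      ≤ ∫⁻ z, ENNReal.ofReal d
          * ((1 / 2) * klDiv (P.condKernel z) (N.condKernel z)) ^ (1 / 2 : ℝ) ∂P.fst := by
        refine lintegral_mono fun z => ?_
        obtain ⟨a, ha⟩ := hd z
        exact enorm_integral_sub_le_klDiv _ _ (hm.comp measurable_prodMk_left) ha
    _ ≤ _ := by
        rw [lintegral_const_mul' _ _ ENNReal.ofReal_ne_top]
        refine mul_le_mul_right ((lintegral_rpow_half_le _ _).trans_eq ?_) _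
        rw [lintegral_const_mul' _ _ (by simp), expectedCondKL]

/-- Splitting an integral over the finitely many classes. -/
theorem integral_eq_sum_condKernel [Fintype Y] [MeasurableSingletonClass Y] (P : Measure (Z × Y))
    [IsFiniteMeasure P] {φ : Z × Y → ℝ} (hm : Measurable φ) {C : ℝ} (hC : ∀ p, ‖φ p‖ ≤ C) :
    ∫ p, φ p ∂P = ∑ y, ∫ z, φ (z, y) * (P.condKernel z).real {y} ∂P.fst := by
  have hint : Integrable φ P :=
    Integrable.of_bound hm.aestronglyMeasurable C (Filter.Eventually.of_forall hC)
  rw [← Measure.integral_condKernel hint, ← integral_finsetSum]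
  · refine integral_congr_ae (Filter.Eventually.of_forall fun z => ?_)
    dsimp only
    rw [integral_fintype (Integrable.of_finite)]
    simp [mul_comm]
  · intro y _
    refine Integrable.of_bound (C := C) ?_ (Filter.Eventually.of_forall fun z => ?_)
    · exact ((hm.comp measurable_prodMk_right).mul
        (P.condKernel.measurable_coe (measurableSet_singleton y)).ennreal_toReal).aestronglyMeasurable
    · have h0 := norm_nonneg (φ (z, y))
      rw [norm_mul, Real.norm_of_nonneg measureReal_nonneg]
      exact (mul_le_of_le_one_right h0 measureReal_le_one).trans (hC _)

theorem classWiseDual_nonneg {c : Z × Y → Z × Y → ℝ} (hc : IsMetric c) (y : Y)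
    (P Q : Measure (Z × Y)) [IsFiniteMeasure P] [IsFiniteMeasure Q] :
    0 ≤ classWiseDual c y P Q := by
  refine le_iSup₂_of_le (fun _ => 0) (fun p q => by simpa using hc.nonneg p q) ?_
  simp

/-- The one function `φ` is a competitor in each supremum, so a sum of suprema dominates the sum
over classes. -/
theorem integral_sub_le_sum_classWiseDual [Fintype Y] [MeasurableSingletonClass Y]
    {c : Z × Y → Z × Y → ℝ} (P Q : Measure (Z × Y)) [IsFiniteMeasure P] [IsFiniteMeasure Q]
    {φ : Z × Y → ℝ} (hφ : IsOneLipschitz c φ) (hm : Measurable φ) {C : ℝ} (hC : ∀ p, ‖φ p‖ ≤ C) :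
    ((∫ p, φ p ∂P - ∫ p, φ p ∂Q : ℝ) : EReal) ≤ ∑ y, classWiseDual c y P Q := by
  rw [integral_eq_sum_condKernel P hm hC, integral_eq_sum_condKernel Q hm hC,
    ← Finset.sum_sub_distrib]
  rw [show ∀ x : Y → ℝ, ((∑ y, x y : ℝ) : EReal) = ∑ y, (x y : EReal) from
    fun x => map_sum (⟨⟨Real.toEReal, EReal.coe_zero⟩, EReal.coe_add⟩ : ℝ →+ EReal) x _]
  exact Finset.sum_le_sum fun y _ => le_iSup₂_of_le φ hφ le_rfl

end

theorem diameter_ne_top {X : Type*} [TopologicalSpace X] [CompactSpace X] {c : X → X → ℝ}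
    (hcc : Continuous fun p : X × X => c p.1 p.2) : diameter c ≠ ∞ := by
  obtain ⟨C, hC⟩ := (isCompact_range hcc).bddAbove
  refine ne_top_of_le_ne_top (ENNReal.ofReal_ne_top (r := C)) (iSup₂_le fun p q => ?_)
  exact ENNReal.ofReal_le_ofReal (hC ⟨(p, q), rfl⟩)

/-- The integral of a 1-Lipschitz function changes little when passing from a distribution to its
observed semi-labelled version. -/
theorem abs_integral_sub_integral_observed_le {Z Y : Type*} [MeasurableSpace Z] [MeasurableSpace Y]
    [StandardBorelSpace Y] [Nonempty Y] [Finite Y]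
    {c : Z × Y → Z × Y → ℝ} (hc : diameter c ≠ ∞) (P : Measure (Z × Y))
    [IsProbabilityMeasure P] (f : Kernel Z Y) [IsMarkovKernel f] {a : ℝ}
    (ha : a ∈ Set.Ioo (0 : ℝ) 1) {φ : Z × Y → ℝ} (hφ : IsOneLipschitz c φ) (hm : Measurable φ)
    {C : ℝ} (hC : ∀ p, ‖φ p‖ ≤ C) :
    ENNReal.ofReal |∫ p, φ p ∂P - ∫ p, φ p ∂(observed a P f)|
      ≤ ENNReal.ofReal (1 - a) * diameter c *
          ((1 / 2) * expectedCondKL (observed a P f).fst P (labelledBy P f)) ^ (1 / 2 : ℝ) := by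
  have hint : ∀ (M : Measure (Z × Y)) [IsFiniteMeasure M], Integrable φ M := fun M _ =>
    Integrable.of_bound hm.aestronglyMeasurable C (Filter.Eventually.of_forall hC)
  have hosc : ∀ z, ∃ b, ∀ y, φ (z, y) ∈ Set.Icc b (b + (diameter c).toReal) := by
    intro z
    -- The minimum over labels is the base of the interval; the Lipschitz bound gives its length.
    obtain ⟨y₀, hy₀⟩ := Finite.exists_min fun y => φ (z, y)
    refine ⟨φ (z, y₀), fun y => ⟨hy₀ y, ?_⟩⟩
    have h1 : ENNReal.ofReal (c (z, y) (z, y₀)) ≤ diameter c :=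
      le_iSup₂ (f := fun p q => ENNReal.ofReal (c p q)) (z, y) (z, y₀)
    have h2 := (ENNReal.ofReal_le_iff_le_toReal hc).1 h1
    linarith [le_abs_self (φ (z, y) - φ (z, y₀)), hφ (z, y) (z, y₀)]
  have h := enorm_integral_sub_le_expectedCondKL P (labelledBy P f) (labelledBy_fst P f) hm
    (hint _) (hint _) hosc
  rw [ENNReal.ofReal_toReal hc, Real.enorm_eq_ofReal_abs] at h
  rw [integral_sub_integral_observed P f ha (hint _) (hint _), observed_fst P f ha, abs_mul,
    abs_of_nonneg (sub_nonneg.2 ha.2.le), ENNReal.ofReal_mul (sub_nonneg.2 ha.2.le), mul_assoc]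
  exact mul_le_mul_right h _

end DomainInvariance

open DomainInvariance in
theorem theorem1 {Z Y : Type*}
    [TopologicalSpace Z] [CompactSpace Z] [TopologicalSpace.MetrizableSpace Z]
    [MeasurableSpace Z] [BorelSpace Z]
    [Fintype Y] [Nonempty Y] [TopologicalSpace Y] [DiscreteTopology Y]
    [MeasurableSpace Y] [DiscreteMeasurableSpace Y]
    (c : Z × Y → Z × Y → ℝ) (hc : IsMetric c)
    (hc_cont : Continuous fun p : (Z × Y) × (Z × Y) => c p.1 p.2)
    (Pt Qt : Measure (Z × Y)) [IsProbabilityMeasure Pt] [IsProbabilityMeasure Qt]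
    (f g : Kernel Z Y) [IsMarkovKernel f] [IsMarkovKernel g]
    (α β : ℝ) (hα : α ∈ Set.Ioo (0 : ℝ) 1) (hβ : β ∈ Set.Ioo (0 : ℝ) 1) :
    (wasserstein c Pt Qt : EReal) ≤
      ((ENNReal.ofReal (1 - α) * diameter c *
          ((1 / 2) * expectedCondKL (observed α Pt f).fst Pt (labelledBy Pt f)) ^ (1 / 2 : ℝ)
            : ℝ≥0∞) : EReal)
        + ∑ y : Y, classWiseDual c y (observed α Pt f) (observed β Qt g)
        + ((ENNReal.ofReal (1 - β) * diameter c *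
          ((1 / 2) * expectedCondKL (observed β Qt g).fst Qt (labelledBy Qt g)) ^ (1 / 2 : ℝ)
            : ℝ≥0∞) : EReal) := by
  have := secondCountableTopology_of_compact_metrizable Z
  have : BorelSpace Y := ⟨by
    rw [borel_eq_top_of_discrete]
    exact top_le_iff.1 fun s _ => MeasurableSet.of_discrete⟩
  have hdiam := diameter_ne_top hc_cont
  set A := ENNReal.ofReal (1 - α) * diameter c *
    ((1 / 2) * expectedCondKL (observed α Pt f).fst Pt (labelledBy Pt f)) ^ (1 / 2 : ℝ)
  set B := ENNReal.ofReal (1 - β) * diameter c *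
    ((1 / 2) * expectedCondKL (observed β Qt g).fst Qt (labelledBy Qt g)) ^ (1 / 2 : ℝ)
  set S := ∑ y : Y, classWiseDual c y (observed α Pt f) (observed β Qt g) with hS
  have hS0 : 0 ≤ S := Finset.sum_nonneg fun y _ => classWiseDual_nonneg hc y _ _
  have hSbot : S ≠ ⊥ := ne_bot_of_le_ne_bot EReal.zero_ne_bot hS0
  -- In `EReal`, `⊤ + ⊥ = ⊥`, so infinite terms make the bound trivial only because no summand is
  -- `⊥`. Otherwise everything is real.
  by_cases hAtop : A = ⊤
  · rw [hAtop, EReal.coe_ennreal_top, EReal.top_add_of_ne_bot hSbot,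
      EReal.top_add_of_ne_bot (EReal.coe_ennreal_ne_bot _)]
    exact le_top
  by_cases hStop : S = ⊤
  · rw [hStop, EReal.add_top_of_ne_bot (EReal.coe_ennreal_ne_bot _),
      EReal.top_add_of_ne_bot (EReal.coe_ennreal_ne_bot _)]
    exact le_top
  by_cases hBtop : B = ⊤
  · rw [hBtop, EReal.coe_ennreal_top, EReal.add_top_of_ne_bot]
    · exact le_top
    · exact ne_bot_of_le_ne_bot EReal.zero_ne_bot (add_nonneg (EReal.coe_ennreal_nonneg _) hS0)
  have hSr : ((S.toReal : ℝ) : EReal) = S := EReal.coe_toReal hStop hSbot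
  have hSr0 : 0 ≤ S.toReal := EReal.toReal_nonneg hS0
  have hW : wasserstein c Pt Qt ≤ ENNReal.ofReal (A.toReal + S.toReal + B.toReal) := by
    refine wasserstein_le_of_isOneLipschitz hc hc_cont Pt Qt _ fun φ hφ => ?_
    have hcont := hφ.continuous hc hc_cont
    obtain ⟨C, hC⟩ := (isCompact_range hcont).isBounded.exists_norm_le
    have hC' : ∀ p, ‖φ p‖ ≤ C := fun p => hC _ ⟨p, rfl⟩
    have h1 := (ENNReal.ofReal_le_iff_le_toReal hAtop).1
      (abs_integral_sub_integral_observed_le hdiam Pt f hα hφ hcont.measurable hC')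
    have h2 := (ENNReal.ofReal_le_iff_le_toReal hBtop).1
      (abs_integral_sub_integral_observed_le hdiam Qt g hβ hφ hcont.measurable hC')
    have h3 := integral_sub_le_sum_classWiseDual (observed α Pt f) (observed β Qt g) hφ
      hcont.measurable hC'
    rw [← hS, ← hSr, EReal.coe_le_coe_iff] at h3
    linarith [(abs_le.1 h1).2, (abs_le.1 h2).1]
  refine (EReal.coe_ennreal_le_coe_ennreal_iff.2 hW).trans_eq ?_
  have hA0 : 0 ≤ A.toReal := ENNReal.toReal_nonneg
  have hB0 : 0 ≤ B.toReal := ENNReal.toReal_nonneg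
  rw [EReal.coe_ennreal_ofReal, max_eq_left (by positivity), EReal.coe_add, EReal.coe_add, hSr,
    EReal.coe_ennreal_toReal hAtop, EReal.coe_ennreal_toReal hBtop]
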